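/- Let $\rho$ and $\sigma$ be density matrices (positive semidefinite, unit trace) on a finite-dimensional Hilbert space $\mathbb{C}^d$ and let $H$ be a Hermitian operator on $\mathbb{C}^d$. If $\rho=\sum_k\lambda_k|\xi_k\rangle\langle\xi_k|$ with $(\xi_k)$ an orthonormal eigenbasis, let $$F_Q[\rho;H]=2\sum_{k,l:\ \lambda_k+\lambda_l>0}\frac{(\lambda_k-\lambda_l)^2}{\lambda_k+\lambda_l}\,|\langle\xi_k|H|\xi_l\rangle|^2$$ be the quantum Fisher information of $\rho$ for the unitary encoding $\rho_\varphi=e^{-iH\varphi}\rho\,e^{iH\varphi}$. Let $\|X\|_1=\mathrm{Tr}\sqrt{X^\dagger X}$ be the trace norm, $\|\cdot\|$ the operator norm, $F(\rho,\sigma)=\|\sqrt\rho\sqrt\sigma\|_1$ the Uhlmann fidelity and $D_B(\rho,\sigma)=\sqrt{2[1-F(\rho,\sigma)]}$ the Bures distance. Then $$\bigl|F_Q[\rho;H]-F_Q[\sigma;H]\bigr|\le 32\sqrt{1-F^2(\rho,\sigma)}\,\|H\|^2,$$ $$\bigl|F_Q[\rho;H]-F_Q[\sigma;H]\bigr|\le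 32\,D_B(\rho,\sigma)\,\|H\|^2,$$ $$\bigl|F_Q[\rho;H]-F_Q[\sigma;H]\bigr|\le 32\sqrt{\|\rho-\sigma\|_1}\,\|H\|^2.$$ -/

import Mathlib

open scoped ComplexOrder MatrixOrder

noncomputable section

/-- A density matrix on `ℂ^n`: a positive semidefinite matrix of unit trace. -/
structure DensityMatrix (n : Type*) [Fintype n] where
  toMatrix : Matrix n n ℂ
  posSemidef : toMatrix.PosSemidef
  trace_eq_one : toMatrix.trace = 1

/-- The operator norm `max_{‖ψ‖ = 1} ‖X ψ‖` of a matrix acting on the Euclidean space `ℂ^n`. -/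
def opNorm {n : Type*} [Fintype n] [DecidableEq n] (X : Matrix n n ℂ) : ℝ :=
  ‖Matrix.toEuclideanCLM (n := n) (𝕜 := ℂ) X‖

/-- The trace norm `‖X‖₁ = Tr √(X† X)` (the trace is a nonnegative real number). -/
def traceNorm {n : Type*} [Fintype n] [DecidableEq n] (X : Matrix n n ℂ) : ℝ :=
  (CFC.sqrt (X.conjTranspose * X)).trace.re

/-- The Uhlmann fidelity `F(ρ, σ) = ‖√ρ √σ‖₁`. -/
def fidelity {n : Type*} [Fintype n] [DecidableEq n] (ρ σ : DensityMatrix n) : ℝ :=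
  traceNorm (CFC.sqrt ρ.toMatrix * CFC.sqrt σ.toMatrix)

/-- The Bures distance `D_B(ρ, σ) = √(2 (1 - F(ρ, σ)))`. -/
def buresDist {n : Type*} [Fintype n] [DecidableEq n] (ρ σ : DensityMatrix n) : ℝ :=
  Real.sqrt (2 * (1 - fidelity ρ σ))

/-- The `k`-th eigenvalue `λ_k` of `ρ`. -/
def DensityMatrix.eigenvalue {n : Type*} [Fintype n] [DecidableEq n]
    (ρ : DensityMatrix n) (k : n) : ℝ :=
  ρ.posSemidef.isHermitian.eigenvalues k

/-- The `k`-th vector `ξ_k` of an orthonormal eigenbasis of `ρ`. -/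
def DensityMatrix.eigenvector {n : Type*} [Fintype n] [DecidableEq n]
    (ρ : DensityMatrix n) (k : n) : EuclideanSpace ℂ n :=
  ρ.posSemidef.isHermitian.eigenvectorBasis k

/-- The quantum Fisher information `F_Q[ρ; H]` of `ρ` for the encoding `U_φ = exp(-i H φ)`:
`2 ∑_{k,l} (λ_k - λ_l)² / (λ_k + λ_l) |⟨ξ_k|H|ξ_l⟩|²`. As usual, the terms with
`λ_k + λ_l = 0` are zero (this agrees with division by zero in Lean). -/
def qfi {n : Type*} [Fintype n] [DecidableEq n] (ρ : DensityMatrix n) (H : Matrix n n ℂ) : ℝ :=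
  2 * ∑ k, ∑ l, (ρ.eigenvalue k - ρ.eigenvalue l) ^ 2 / (ρ.eigenvalue k + ρ.eigenvalue l) *
    ‖inner ℂ (ρ.eigenvector k) (Matrix.toEuclideanCLM (n := n) (𝕜 := ℂ) H (ρ.eigenvector l))‖ ^ 2

end

/-!
Identify a purification of `ρ` with a matrix `Ψ` such that `Ψ Ψᴴ = ρ`; a Hermitian generator `h` on
the ancilla acts on it by right multiplication. The proof rests on the variational formula

  `F_Q[ρ; H] = 4 min_h ‖H Ψ + Ψ h‖₂²`,

where `‖·‖₂` is the Hilbert-Schmidt norm and `h` ranges over the Hermitian matrices. Every `h` gives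
an upper bound (`qfi_le_four_mul_norm_hsVec_sq`), by completing the square in each pair of entries
`(k, l)`, `(l, k)` in an eigenbasis of `ρ`. For `Ψ = √ρ` the minimum is attained at the matrix `h`
that has the entries `-2 √(λₖ λₗ) / (λₖ + λₗ) Hₖₗ` in that eigenbasis. It satisfies
`‖h‖ ≤ ‖H‖` (`abs_eigenvalues_optimalGenerator_le`): if `h v = μ v`, then the Sylvester equation
`h ρ + ρ h = -2 √ρ H √ρ` gives `μ ‖√ρ v‖² = -⟨√ρ v, H √ρ v⟩`.

Given `ρ` and `σ`, take `Φ = √σ` with its optimal `h`, and `Ψ = √ρ W` with a unitary `W` such that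
`Re ⟨Ψ, Φ⟩` is the fidelity (`exists_unitary_inner_eq_fidelity`). The linear map
`T X = H X + X h` has norm at most `2 ‖H‖`, and therefore

  `F_Q[ρ; H] - F_Q[σ; H] ≤ 4 (‖T Ψ‖₂² - ‖T Φ‖₂²) ≤ 16 ‖H‖² ‖Ψ - Φ‖₂ ‖Ψ + Φ‖₂`,

where `‖Ψ ∓ Φ‖₂² = 2 (1 ∓ F)`, so that the right-hand side is `32 √(1 - F²) ‖H‖²`. The bound by the
Bures distance follows from `1 - F² ≤ 2 (1 - F)`, and the bound by the trace norm from
`2 (1 - F) ≤ ‖√ρ - √σ‖₂² ≤ ‖ρ - σ‖₁` (`two_mul_one_sub_fidelity_le_traceNorm`).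
-/

open Matrix

/-! ### Unitary diagonalization and square roots -/

section UnitaryDiagonalization

variable {n : Type*} [Fintype n] [DecidableEq n]

theorem Matrix.IsHermitian.eq_unitary_mul_diagonal_mul {A : Matrix n n ℂ} (hA : A.IsHermitian) :
    A = (hA.eigenvectorUnitary : Matrix n n ℂ) * diagonal (fun i => (hA.eigenvalues i : ℂ)) *
      (hA.eigenvectorUnitary : Matrix n n ℂ)ᴴ := by
  conv_lhs => rw [hA.spectral_theorem]
  rfl

theorem conjTranspose_mul_self_of_mem_unitaryGroup {U : Matrix n n ℂ}
    (hU : U ∈ unitaryGroup n ℂ) : Uᴴ * U = 1 := mem_unitaryGroup_iff'.mp hU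

theorem self_mul_conjTranspose_of_mem_unitaryGroup {U : Matrix n n ℂ}
    (hU : U ∈ unitaryGroup n ℂ) : U * Uᴴ = 1 := mem_unitaryGroup_iff.mp hU

theorem conjTranspose_mem_unitaryGroup {U : Matrix n n ℂ}
    (hU : U ∈ unitaryGroup n ℂ) : Uᴴ ∈ unitaryGroup n ℂ := Unitary.star_mem hU

theorem sqrt_unitary_mul_diagonal_sq_mul {U : Matrix n n ℂ} (hU : U ∈ unitaryGroup n ℂ)
    {d : n → ℝ} (hd : ∀ i, 0 ≤ d i) :
    CFC.sqrt (U * diagonal (fun i => ((d i ^ 2 : ℝ) : ℂ)) * Uᴴ) =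
      U * diagonal (fun i => (d i : ℂ)) * Uᴴ := by
  apply CFC.sqrt_unique
  · have h := conjTranspose_mul_self_of_mem_unitaryGroup hU
    calc U * diagonal (fun i => (d i : ℂ)) * Uᴴ * (U * diagonal (fun i => (d i : ℂ)) * Uᴴ)
        = U * diagonal (fun i => (d i : ℂ)) * (Uᴴ * U) * diagonal (fun i => (d i : ℂ)) * Uᴴ := by
          simp only [Matrix.mul_assoc]
      _ = _ := by
          rw [h, Matrix.mul_one, Matrix.mul_assoc U, diagonal_mul_diagonal]
          simp [sq]
  · rw [Matrix.nonneg_iff_posSemidef]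
    refine PosSemidef.mul_mul_conjTranspose_same (PosSemidef.diagonal fun i => ?_) U
    simpa using hd i

theorem Matrix.PosSemidef.sqrt_eq_unitary_mul_diagonal_mul {A : Matrix n n ℂ}
    (hA : A.PosSemidef) :
    CFC.sqrt A = (hA.1.eigenvectorUnitary : Matrix n n ℂ) *
      diagonal (fun i => (√(hA.1.eigenvalues i) : ℂ)) *
      (hA.1.eigenvectorUnitary : Matrix n n ℂ)ᴴ := by
  rw [← sqrt_unitary_mul_diagonal_sq_mul (hA.1.eigenvectorUnitary).2
    (fun i => Real.sqrt_nonneg _)]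
  simp only [Real.sq_sqrt (hA.eigenvalues_nonneg _)]
  rw [← hA.1.eq_unitary_mul_diagonal_mul]

theorem isHermitian_sqrt (A : Matrix n n ℂ) : (CFC.sqrt A).IsHermitian :=
  (Matrix.nonneg_iff_posSemidef.mp (CFC.sqrt_nonneg A)).1

end UnitaryDiagonalization

/-! ### Singular values and the trace norm -/

section SingularValues

variable {n : Type*} [Fintype n] [DecidableEq n]

/-- Singular value decomposition of a square matrix. -/
theorem exists_singular_value_decomposition (X : Matrix n n ℂ) :
    ∃ W ∈ unitaryGroup n ℂ, ∃ V ∈ unitaryGroup n ℂ, ∃ s : n → ℝ, (∀ i, 0 ≤ s i) ∧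
      X = W * diagonal (fun i => (s i : ℂ)) * Vᴴ := by
  have hA := isHermitian_conjTranspose_mul_self X
  set V : Matrix n n ℂ := (hA.eigenvectorUnitary : Matrix n n ℂ)
  have hVu : V ∈ unitaryGroup n ℂ := hA.eigenvectorUnitary.2
  have hVV := conjTranspose_mul_self_of_mem_unitaryGroup hVu
  set Y := X * V with hY
  have hYY : Yᴴ * Y = diagonal (fun i => (hA.eigenvalues i : ℂ)) := by
    calc Yᴴ * Y = Vᴴ * (Xᴴ * X) * V := by simp [hY, Matrix.mul_assoc]
      _ = Vᴴ * (V * diagonal (fun i => (hA.eigenvalues i : ℂ)) * Vᴴ) * V := by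
          rw [← hA.eq_unitary_mul_diagonal_mul]
      _ = (Vᴴ * V) * diagonal (fun i => (hA.eigenvalues i : ℂ)) * (Vᴴ * V) := by
          simp only [Matrix.mul_assoc]
      _ = _ := by simp [hVV]
  -- The columns of `Y` are orthogonal: normalize the nonzero ones, and extend to a basis.
  let f : n → EuclideanSpace ℂ n := fun j => WithLp.toLp 2 (Yᵀ j)
  have hf : ∀ i j, i ≠ j → inner ℂ (f i) (f j) = 0 := by
    intro i j hij
    have h : (Yᴴ * Y) i j = 0 := by rw [hYY, diagonal_apply_ne _ hij]
    rw [← h, EuclideanSpace.inner_eq_star_dotProduct]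
    simp [f, Matrix.mul_apply, dotProduct, mul_comm]
  have hon : Orthonormal ℂ (({i | f i ≠ 0} : Set n).domRestrict
      fun i => ((‖f i‖⁻¹ : ℝ) : ℂ) • f i) := by
    refine ⟨fun i => ?_, fun i j hij => ?_⟩
    · have : ‖f i‖ ≠ 0 := norm_ne_zero_iff.mpr i.2
      simp [norm_smul, this]
    · have := hf i j (fun h => hij (Subtype.ext h))
      simp [inner_smul_left, inner_smul_right, this]
  obtain ⟨b, hb⟩ := hon.exists_orthonormalBasis_extension_of_card_eq (by simp)
  refine ⟨_, (EuclideanSpace.basisFun n ℂ).toMatrix_orthonormalBasis_mem_unitary b, V, hVu,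
    fun i => ‖f i‖, fun i => norm_nonneg _, ?_⟩
  have hYW : Y = (EuclideanSpace.basisFun n ℂ).toBasis.toMatrix b *
      diagonal (fun i => (‖f i‖ : ℂ)) := by
    ext i j
    have h1 : f j = (‖f j‖ : ℂ) • b j := by
      by_cases h0 : f j = 0
      · simp [h0]
      · have : (‖f j‖ : ℂ) ≠ 0 := by simpa using h0
        rw [hb j h0, smul_smul]
        simp [this]
    have h2 := congrArg (fun v : EuclideanSpace ℂ n => v i) h1
    simp only [mul_diagonal, Module.Basis.toMatrix_apply]
    simpa [f, mul_comm] using h2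
  rw [← hYW, hY, Matrix.mul_assoc, self_mul_conjTranspose_of_mem_unitaryGroup hVu, Matrix.mul_one]

theorem traceNorm_eq_sum_singular_values {W V : Matrix n n ℂ} (hW : W ∈ unitaryGroup n ℂ)
    (hV : V ∈ unitaryGroup n ℂ) {s : n → ℝ} (hs : ∀ i, 0 ≤ s i) :
    traceNorm (W * diagonal (fun i => (s i : ℂ)) * Vᴴ) = ∑ i, s i := by
  have hWW := conjTranspose_mul_self_of_mem_unitaryGroup hW
  have hVV := conjTranspose_mul_self_of_mem_unitaryGroup hV
  have h : (W * diagonal (fun i => (s i : ℂ)) * Vᴴ)ᴴ * (W * diagonal (fun i => (s i : ℂ)) * Vᴴ) =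
      V * diagonal (fun i => ((s i ^ 2 : ℝ) : ℂ)) * Vᴴ := by
    have hd : (diagonal (fun i => (s i : ℂ)))ᴴ = diagonal (fun i => (s i : ℂ)) := by
      rw [diagonal_conjTranspose]
      congr 1
      ext i
      simp
    calc _ = V * (diagonal (fun i => (s i : ℂ)) * (Wᴴ * W) * diagonal (fun i => (s i : ℂ))) *
          Vᴴ := by
          simp only [conjTranspose_mul, conjTranspose_conjTranspose, hd, Matrix.mul_assoc]
      _ = _ := by
          rw [hWW, Matrix.mul_one, diagonal_mul_diagonal]
          simp [sq]
  rw [traceNorm, h, sqrt_unitary_mul_diagonal_sq_mul hV hs, trace_mul_cycle, hVV, Matrix.one_mul,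
    trace_diagonal]
  simp

theorem exists_unitary_trace_mul_eq_traceNorm (X : Matrix n n ℂ) :
    ∃ U ∈ unitaryGroup n ℂ, (X * U).trace = traceNorm X := by
  obtain ⟨W, hW, V, hV, s, hs, rfl⟩ := exists_singular_value_decomposition X
  refine ⟨V * Wᴴ, mul_mem hV (conjTranspose_mem_unitaryGroup hW), ?_⟩
  rw [traceNorm_eq_sum_singular_values hW hV hs]
  calc _ = (W * (diagonal (fun i => (s i : ℂ)) * (Vᴴ * V)) * Wᴴ).trace := by
        simp only [Matrix.mul_assoc]
    _ = _ := by
        rw [conjTranspose_mul_self_of_mem_unitaryGroup hV, Matrix.mul_one, trace_mul_cycle,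
          conjTranspose_mul_self_of_mem_unitaryGroup hW, Matrix.one_mul, trace_diagonal]
        simp

theorem re_trace_mul_le_traceNorm (X : Matrix n n ℂ) {U : Matrix n n ℂ}
    (hU : U ∈ unitaryGroup n ℂ) : (X * U).trace.re ≤ traceNorm X := by
  obtain ⟨W, hW, V, hV, s, hs, rfl⟩ := exists_singular_value_decomposition X
  rw [traceNorm_eq_sum_singular_values hW hV hs]
  have hZ : Vᴴ * U * W ∈ unitaryGroup n ℂ :=
    mul_mem (mul_mem (conjTranspose_mem_unitaryGroup hV) hU) hW
  have h : (W * diagonal (fun i => (s i : ℂ)) * Vᴴ * U).trace =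
      (Vᴴ * U * W * diagonal (fun i => (s i : ℂ))).trace := by
    rw [Matrix.mul_assoc, trace_mul_comm, Matrix.mul_assoc (Vᴴ * U)]
  rw [h]
  simp only [trace, diag_apply, mul_diagonal, Complex.re_sum]
  refine Finset.sum_le_sum fun i _ => ?_
  rw [Complex.re_mul_ofReal]
  exact mul_le_of_le_one_left (hs i)
    ((Complex.re_le_norm _).trans (entry_norm_bound_of_unitary hZ i i))

end SingularValues

/-! ### The Hilbert-Schmidt norm -/

section HilbertSchmidt

variable {n : Type*}

/-- The entries of a matrix, as a vector of the Euclidean space `ℂ^(n × n)`: the norm of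
`hsVec X` is the Hilbert-Schmidt norm of `X`, and inner products are `Tr (Aᴴ B)`. -/
noncomputable def hsVec (X : Matrix n n ℂ) : EuclideanSpace ℂ (n × n) :=
  WithLp.toLp 2 fun p => X p.1 p.2

theorem hsVec_add (A B : Matrix n n ℂ) : hsVec (A + B) = hsVec A + hsVec B := rfl

theorem hsVec_sub (A B : Matrix n n ℂ) : hsVec (A - B) = hsVec A - hsVec B := rfl

variable [Fintype n]

theorem inner_hsVec (A B : Matrix n n ℂ) : inner ℂ (hsVec A) (hsVec B) = (Aᴴ * B).trace := by
  simp only [PiLp.inner_apply, hsVec, trace, diag_apply, mul_apply, conjTranspose_apply,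
    Fintype.sum_prod_type]
  rw [Finset.sum_comm]
  simp [mul_comm]

theorem norm_hsVec_sq (X : Matrix n n ℂ) : ‖hsVec X‖ ^ 2 = ∑ i, ∑ j, ‖X i j‖ ^ 2 := by
  simp [EuclideanSpace.norm_sq_eq, hsVec, Fintype.sum_prod_type]

theorem norm_hsVec_sq_eq_trace (X : Matrix n n ℂ) : ‖hsVec X‖ ^ 2 = (Xᴴ * X).trace.re := by
  rw [← inner_hsVec, ← inner_self_eq_norm_sq (𝕜 := ℂ)]
  rfl

variable [DecidableEq n]

theorem norm_hsVec_unitary_mul {U : Matrix n n ℂ} (hU : U ∈ unitaryGroup n ℂ)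
    (X : Matrix n n ℂ) : ‖hsVec (U * X)‖ = ‖hsVec X‖ := by
  rw [← sq_eq_sq₀ (norm_nonneg _) (norm_nonneg _), norm_hsVec_sq_eq_trace,
    norm_hsVec_sq_eq_trace, conjTranspose_mul, Matrix.mul_assoc, ← Matrix.mul_assoc Uᴴ,
    conjTranspose_mul_self_of_mem_unitaryGroup hU, Matrix.one_mul]

theorem norm_hsVec_mul_unitary {U : Matrix n n ℂ} (hU : U ∈ unitaryGroup n ℂ)
    (X : Matrix n n ℂ) : ‖hsVec (X * U)‖ = ‖hsVec X‖ := by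
  rw [← sq_eq_sq₀ (norm_nonneg _) (norm_nonneg _), norm_hsVec_sq_eq_trace,
    norm_hsVec_sq_eq_trace, conjTranspose_mul, Matrix.mul_assoc, trace_mul_comm,
    Matrix.mul_assoc, Matrix.mul_assoc, self_mul_conjTranspose_of_mem_unitaryGroup hU,
    Matrix.mul_one]

theorem norm_hsVec_mul_le (H X : Matrix n n ℂ) : ‖hsVec (H * X)‖ ≤ opNorm H * ‖hsVec X‖ := by
  have h0 : 0 ≤ opNorm H := norm_nonneg _
  rw [← sq_le_sq₀ (norm_nonneg _) (by positivity), mul_pow, norm_hsVec_sq, norm_hsVec_sq,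
    Finset.sum_comm, Finset.sum_comm (f := fun i j => ‖X i j‖ ^ 2), Finset.mul_sum]
  refine Finset.sum_le_sum fun j _ => ?_
  have h := (toEuclideanCLM (n := n) (𝕜 := ℂ) H).le_opNorm (WithLp.toLp 2 (Xᵀ j))
  have h2 := pow_le_pow_left₀ (norm_nonneg _) h 2
  rw [mul_pow, EuclideanSpace.norm_sq_eq, EuclideanSpace.norm_sq_eq] at h2
  simpa [Matrix.mulVec, dotProduct, mul_apply, opNorm] using h2

theorem norm_hsVec_mul_le_of_eigenvalues {M : Matrix n n ℂ} (hM : M.IsHermitian) {t : ℝ}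
    (ht : 0 ≤ t) (h : ∀ i, |hM.eigenvalues i| ≤ t) (X : Matrix n n ℂ) :
    ‖hsVec (X * M)‖ ≤ t * ‖hsVec X‖ := by
  have hV := hM.eigenvectorUnitary.2
  have hXM : ‖hsVec (X * M)‖ = ‖hsVec (X * (hM.eigenvectorUnitary : Matrix n n ℂ) *
      diagonal fun i => (hM.eigenvalues i : ℂ))‖ := by
    conv_lhs => rw [hM.eq_unitary_mul_diagonal_mul, ← Matrix.mul_assoc,
      norm_hsVec_mul_unitary (conjTranspose_mem_unitaryGroup hV), ← Matrix.mul_assoc]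
  rw [hXM, ← norm_hsVec_mul_unitary hV X, ← sq_le_sq₀ (norm_nonneg _) (by positivity), mul_pow,
    norm_hsVec_sq, norm_hsVec_sq, Finset.mul_sum]
  refine Finset.sum_le_sum fun i _ => ?_
  rw [Finset.mul_sum]
  refine Finset.sum_le_sum fun j _ => ?_
  rw [mul_diagonal, norm_mul, mul_pow, mul_comm, Complex.norm_real, Real.norm_eq_abs]
  gcongr
  exact h j

end HilbertSchmidt

/-! ### Fidelity, Uhlmann's theorem and the Fuchs-van de Graaf inequality -/

section Fidelity

variable {n : Type*} [Fintype n] [DecidableEq n]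

theorem DensityMatrix.sqrt_mul_sqrt (ρ : DensityMatrix n) :
    CFC.sqrt ρ.toMatrix * CFC.sqrt ρ.toMatrix = ρ.toMatrix :=
  CFC.sqrt_mul_sqrt_self _ (Matrix.nonneg_iff_posSemidef.mpr ρ.posSemidef)

theorem DensityMatrix.norm_hsVec_sqrt (ρ : DensityMatrix n) :
    ‖hsVec (CFC.sqrt ρ.toMatrix)‖ ^ 2 = 1 := by
  rw [norm_hsVec_sq_eq_trace, (isHermitian_sqrt _).eq, ρ.sqrt_mul_sqrt, ρ.trace_eq_one,
    Complex.one_re]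

theorem fidelity_nonneg (ρ σ : DensityMatrix n) : 0 ≤ fidelity ρ σ := by
  obtain ⟨W, hW, V, hV, s, hs, h⟩ :=
    exists_singular_value_decomposition (CFC.sqrt ρ.toMatrix * CFC.sqrt σ.toMatrix)
  rw [fidelity, h, traceNorm_eq_sum_singular_values hW hV hs]
  exact Finset.sum_nonneg fun i _ => hs i

theorem fidelity_comm (ρ σ : DensityMatrix n) : fidelity ρ σ = fidelity σ ρ := by
  obtain ⟨W, hW, V, hV, s, hs, h⟩ :=
    exists_singular_value_decomposition (CFC.sqrt ρ.toMatrix * CFC.sqrt σ.toMatrix)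
  have h' : CFC.sqrt σ.toMatrix * CFC.sqrt ρ.toMatrix =
      V * diagonal (fun i => (s i : ℂ)) * Wᴴ := by
    have h2 := congrArg conjTranspose h
    rw [conjTranspose_mul, (isHermitian_sqrt _).eq, (isHermitian_sqrt _).eq] at h2
    rw [h2, conjTranspose_mul, conjTranspose_mul, conjTranspose_conjTranspose,
      (isHermitian_diagonal_of_self_adjoint _ (funext fun i => by simp)).eq, Matrix.mul_assoc]
  rw [fidelity, fidelity, h, h', traceNorm_eq_sum_singular_values hW hV hs,
    traceNorm_eq_sum_singular_values hV hW hs]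

/-- Uhlmann's theorem: `√ρ W` is a purification of `ρ` whose overlap with the purification `√σ` of
`σ` is the fidelity. -/
theorem exists_unitary_inner_eq_fidelity (ρ σ : DensityMatrix n) :
    ∃ W ∈ unitaryGroup n ℂ,
      (inner ℂ (hsVec (CFC.sqrt ρ.toMatrix * W)) (hsVec (CFC.sqrt σ.toMatrix)) : ℂ).re =
        fidelity ρ σ := by
  obtain ⟨U, hU, h⟩ :=
    exists_unitary_trace_mul_eq_traceNorm (CFC.sqrt ρ.toMatrix * CFC.sqrt σ.toMatrix)
  refine ⟨Uᴴ, conjTranspose_mem_unitaryGroup hU, ?_⟩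
  rw [inner_hsVec, conjTranspose_mul, conjTranspose_conjTranspose, (isHermitian_sqrt _).eq,
    Matrix.mul_assoc, trace_mul_comm, h, fidelity, Complex.ofReal_re]

theorem fidelity_le_one (ρ σ : DensityMatrix n) : fidelity ρ σ ≤ 1 := by
  obtain ⟨W, hW, h⟩ := exists_unitary_inner_eq_fidelity ρ σ
  have h1 := ρ.norm_hsVec_sqrt
  rw [← norm_hsVec_mul_unitary hW] at h1
  have h2 := σ.norm_hsVec_sqrt
  have h3 : (inner ℂ (hsVec (CFC.sqrt ρ.toMatrix * W)) (hsVec (CFC.sqrt σ.toMatrix)) : ℂ).re ≤ _ :=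
    re_inner_le_norm (𝕜 := ℂ) _ _
  rw [h] at h3
  nlinarith [norm_nonneg (hsVec (CFC.sqrt ρ.toMatrix * W)),
    norm_nonneg (hsVec (CFC.sqrt σ.toMatrix))]

/-- Fuchs-van de Graaf inequality, by way of the Powers-Størmer inequality
`‖√ρ - √σ‖₂² ≤ ‖ρ - σ‖₁`. -/
theorem two_mul_one_sub_fidelity_le_traceNorm (ρ σ : DensityMatrix n) :
    2 * (1 - fidelity ρ σ) ≤ traceNorm (ρ.toMatrix - σ.toMatrix) := by
  set A := CFC.sqrt ρ.toMatrix
  set B := CFC.sqrt σ.toMatrix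
  have hAp : A.PosSemidef := Matrix.nonneg_iff_posSemidef.mp (CFC.sqrt_nonneg _)
  have hBp : B.PosSemidef := Matrix.nonneg_iff_posSemidef.mp (CFC.sqrt_nonneg _)
  have hD : (A - B).IsHermitian := hAp.1.sub hBp.1
  set V : Matrix n n ℂ := (hD.eigenvectorUnitary : Matrix n n ℂ)
  have hV : V ∈ unitaryGroup n ℂ := hD.eigenvectorUnitary.2
  have hVV := conjTranspose_mul_self_of_mem_unitaryGroup hV
  have hVV' := self_mul_conjTranspose_of_mem_unitaryGroup hV
  set d : n → ℝ := hD.eigenvalues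
  set E : Matrix n n ℂ := diagonal fun i => (d i : ℂ) with hE
  have hdiag : A - B = V * E * Vᴴ := hD.eq_unitary_mul_diagonal_mul
  -- In an eigenbasis of `√ρ - √σ`, with `P` and `Q` the matrices of `√ρ` and `√σ`.
  set P := Vᴴ * A * V with hP
  set Q := Vᴴ * B * V with hQ
  have hPp : P.PosSemidef := hAp.conjTranspose_mul_mul_same V
  have hQp : Q.PosSemidef := hBp.conjTranspose_mul_mul_same V
  have hPQ : P - Q = E := by
    calc P - Q = Vᴴ * (A - B) * V := by rw [hP, hQ, Matrix.mul_sub, Matrix.sub_mul]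
      _ = (Vᴴ * V) * E * (Vᴴ * V) := by rw [hdiag]; simp only [Matrix.mul_assoc]
      _ = E := by rw [hVV, Matrix.one_mul, Matrix.mul_one]
  have hconj : ∀ C : Matrix n n ℂ, Vᴴ * (C * C) * V = (Vᴴ * C * V) * (Vᴴ * C * V) := by
    intro C
    calc Vᴴ * (C * C) * V = Vᴴ * C * 1 * C * V := by simp only [Matrix.mul_assoc, Matrix.one_mul]
      _ = _ := by rw [← hVV']; simp only [Matrix.mul_assoc]
  have hR : Vᴴ * (ρ.toMatrix - σ.toMatrix) * V = P * P - Q * Q := by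
    rw [← ρ.sqrt_mul_sqrt, ← σ.sqrt_mul_sqrt, Matrix.mul_sub, Matrix.sub_mul, hconj, hconj]
  have hPr : ∀ i, 0 ≤ (P i i).re := fun i => (Complex.le_def.mp (hPp.diag_nonneg (i := i))).1
  have hQr : ∀ i, 0 ≤ (Q i i).re := fun i => (Complex.le_def.mp (hQp.diag_nonneg (i := i))).1
  have hPQd : ∀ i, (P i i).re - (Q i i).re = d i := by
    intro i
    have := congrArg (fun M : Matrix n n ℂ => (M i i).re) hPQ
    simpa [hE] using this
  have hRd : ∀ i, ((P * P - Q * Q) i i).re = d i * ((P i i).re + (Q i i).re) := by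
    intro i
    have h : (P * P - Q * Q) + (P * P - Q * Q) = E * (P + Q) + (P + Q) * E := by
      rw [← hPQ]; noncomm_ring
    have h2 := congrArg (fun M : Matrix n n ℂ => (M i i).re) h
    simp only [Matrix.add_apply, hE, diagonal_mul, mul_diagonal, Complex.add_re,
      Complex.re_ofReal_mul, Complex.re_mul_ofReal] at h2
    linarith
  -- Test the trace norm against the unitary with the signs of `d` in that eigenbasis.
  let ε : n → ℝ := fun i => if 0 ≤ d i then 1 else -1
  have hε : ∀ i, ε i * ε i = 1 := fun i => by simp only [ε]; split_ifs <;> norm_num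
  have hεd : ∀ i, ε i * d i = |d i| := fun i => by
    simp only [ε]; split_ifs with h
    · rw [abs_of_nonneg h, one_mul]
    · rw [abs_of_neg (not_le.mp h), neg_one_mul]
  set S : Matrix n n ℂ := diagonal fun i => (ε i : ℂ) with hS
  have hSu : S ∈ unitaryGroup n ℂ := by
    rw [mem_unitaryGroup_iff, star_eq_conjTranspose, hS, diagonal_conjTranspose,
      diagonal_mul_diagonal, ← diagonal_one]
    congr 1
    ext i
    simp [← Complex.ofReal_mul, hε]
  have hle := re_trace_mul_le_traceNorm (ρ.toMatrix - σ.toMatrix)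
    (mul_mem (mul_mem hV hSu) (conjTranspose_mem_unitaryGroup hV))
  have htr : ((ρ.toMatrix - σ.toMatrix) * (V * S * Vᴴ)).trace = ((P * P - Q * Q) * S).trace := by
    rw [← hR, ← Matrix.mul_assoc, trace_mul_comm]
    simp only [Matrix.mul_assoc]
  have hsum : ∑ i, d i ^ 2 ≤ ((P * P - Q * Q) * S).trace.re := by
    simp only [trace, diag_apply, hS, mul_diagonal, Complex.re_sum, Complex.re_mul_ofReal, hRd]
    refine Finset.sum_le_sum fun i _ => ?_
    have h1 : |d i| ≤ (P i i).re + (Q i i).re := by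
      rw [abs_le, ← hPQd i]
      constructor <;> linarith [hPr i, hQr i]
    calc d i ^ 2 = |d i| * |d i| := by rw [abs_mul_abs_self, sq]
      _ ≤ |d i| * ((P i i).re + (Q i i).re) := by gcongr
      _ = _ := by rw [← hεd i]; ring
  have hnorm : ‖hsVec A - hsVec B‖ ^ 2 = ∑ i, d i ^ 2 := by
    rw [← hsVec_sub, hdiag, norm_hsVec_mul_unitary (conjTranspose_mem_unitaryGroup hV),
      norm_hsVec_unitary_mul hV, norm_hsVec_sq_eq_trace, hE, diagonal_conjTranspose,
      diagonal_mul_diagonal, trace_diagonal, Complex.re_sum]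
    simp [sq]
  have hF : (inner ℂ (hsVec A) (hsVec B) : ℂ).re ≤ fidelity ρ σ := by
    have := re_trace_mul_le_traceNorm (A * B) (one_mem (unitaryGroup n ℂ))
    rw [Matrix.mul_one] at this
    rwa [inner_hsVec, hAp.1.eq]
  have hexp := norm_sub_sq (𝕜 := ℂ) (hsVec A) (hsVec B)
  rw [ρ.norm_hsVec_sqrt, σ.norm_hsVec_sqrt] at hexp
  have hexp' : ‖hsVec A - hsVec B‖ ^ 2 = 1 - 2 * (inner ℂ (hsVec A) (hsVec B) : ℂ).re + 1 := hexp
  rw [htr] at hle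
  linarith

end Fidelity

/-! ### The variational formula for the quantum Fisher information -/

section Variational

variable {n : Type*}

/-- A minimizer `M` of `‖G R + R M‖₂` over Hermitian matrices, for `R = diagonal r`. Where both
`r k` and `r l` vanish, the entry is zero (division by zero). -/
noncomputable def optimalGenerator (r : n → ℝ) (G : Matrix n n ℂ) : Matrix n n ℂ :=
  Matrix.of fun k l => ((-(2 * r k * r l / (r k ^ 2 + r l ^ 2)) : ℝ) : ℂ) * G k l

theorem optimalGenerator_isHermitian (r : n → ℝ) {G : Matrix n n ℂ} (hG : G.IsHermitian) :
    (optimalGenerator r G).IsHermitian := by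
  ext k l
  simp only [conjTranspose_apply, optimalGenerator, of_apply, star_mul', hG.apply]
  congr 1
  rw [mul_right_comm 2, add_comm]
  exact Complex.conj_ofReal _

variable [Fintype n] [DecidableEq n]

theorem opNorm_conjTranspose_mul_mul_of_mem_unitaryGroup {U : Matrix n n ℂ}
    (hU : U ∈ unitaryGroup n ℂ) (H : Matrix n n ℂ) : opNorm (Uᴴ * H * U) = opNorm H := by
  have h := Unitary.map_mem (toEuclideanCLM (n := n) (𝕜 := ℂ)) hU
  have h' := Unitary.map_mem (toEuclideanCLM (n := n) (𝕜 := ℂ)) (conjTranspose_mem_unitaryGroup hU)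
  rw [opNorm, opNorm, map_mul, map_mul, CStarRing.norm_mul_mem_unitary _ h,
    CStarRing.norm_mem_unitary_mul _ h']

theorem re_star_dotProduct_mulVec_abs_le (G : Matrix n n ℂ) (u : n → ℂ) :
    |(star u ⬝ᵥ G *ᵥ u).re| ≤ opNorm G * (star u ⬝ᵥ u).re := by
  set x : EuclideanSpace ℂ n := WithLp.toLp 2 u
  have h1 : star u ⬝ᵥ G *ᵥ u = inner ℂ x (toEuclideanCLM (n := n) (𝕜 := ℂ) G x) := by
    rw [EuclideanSpace.inner_eq_star_dotProduct, dotProduct_comm]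
    rfl
  have h2 : (star u ⬝ᵥ u).re = ‖x‖ ^ 2 := by
    rw [← inner_self_eq_norm_sq (𝕜 := ℂ), EuclideanSpace.inner_eq_star_dotProduct, dotProduct_comm]
    rfl
  rw [h1, h2]
  calc
    _ ≤ ‖inner ℂ x (toEuclideanCLM (n := n) (𝕜 := ℂ) G x)‖ := Complex.abs_re_le_norm _
    _ ≤ ‖x‖ * (‖toEuclideanCLM (n := n) (𝕜 := ℂ) G‖ * ‖x‖) :=
      (norm_inner_le_norm _ _).trans
        (mul_le_mul_of_nonneg_left (ContinuousLinearMap.le_opNorm _ _) (norm_nonneg _))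
    _ = _ := by rw [opNorm]; ring

theorem qfi_eq_sum_entries (ρ : DensityMatrix n) (H : Matrix n n ℂ) :
    qfi ρ H = 2 * ∑ k, ∑ l, (ρ.eigenvalue k - ρ.eigenvalue l) ^ 2 /
      (ρ.eigenvalue k + ρ.eigenvalue l) *
      ‖((ρ.posSemidef.1.eigenvectorUnitary : Matrix n n ℂ)ᴴ * H *
        (ρ.posSemidef.1.eigenvectorUnitary : Matrix n n ℂ)) k l‖ ^ 2 := by
  rw [qfi]
  congr! 8 with k _ l _
  rw [EuclideanSpace.inner_eq_star_dotProduct, dotProduct_comm, Matrix.mul_assoc]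
  rfl

/-- Completing the square: the two sides differ by
`‖(x² + y²) b + 2 x y a‖² / (x² + y²)`. -/
theorem sq_sub_sq_div_mul_norm_sq_le (x y : ℝ) (a b : ℂ) :
    (x ^ 2 - y ^ 2) ^ 2 / (x ^ 2 + y ^ 2) * ‖a‖ ^ 2 ≤
      ‖a * y + x * b‖ ^ 2 + ‖star a * x + y * star b‖ ^ 2 := by
  rcases (add_nonneg (sq_nonneg x) (sq_nonneg y)).eq_or_lt with h | h
  · rw [← h, div_zero, zero_mul]
    positivity
  · rw [div_mul_eq_mul_div, div_le_iff₀ h, ← Complex.normSq_eq_norm_sq,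
      ← Complex.normSq_eq_norm_sq, ← Complex.normSq_eq_norm_sq]
    simp [Complex.normSq_apply]
    nlinarith [sq_nonneg ((x ^ 2 + y ^ 2) * b.re + 2 * x * y * a.re),
      sq_nonneg ((x ^ 2 + y ^ 2) * b.im + 2 * x * y * a.im)]

theorem sq_sub_sq_div_mul_norm_sq_eq (x y : ℝ) (a b : ℂ)
    (hb : b = ((-(2 * x * y / (x ^ 2 + y ^ 2)) : ℝ) : ℂ) * a) :
    (x ^ 2 - y ^ 2) ^ 2 / (x ^ 2 + y ^ 2) * ‖a‖ ^ 2 =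
      ‖a * y + x * b‖ ^ 2 + ‖star a * x + y * star b‖ ^ 2 := by
  rcases (add_nonneg (sq_nonneg x) (sq_nonneg y)).eq_or_lt with h | h
  · obtain rfl : x = 0 := by nlinarith [sq_nonneg x, sq_nonneg y]
    obtain rfl : y = 0 := by nlinarith [sq_nonneg y]
    simp
  · subst hb
    rw [← Complex.normSq_eq_norm_sq, ← Complex.normSq_eq_norm_sq, ← Complex.normSq_eq_norm_sq]
    simp [-Complex.ofReal_neg, -Complex.ofReal_div, Complex.normSq_apply]
    field_simp
    ring

/-- The sum of `‖(G R + R M)ₖₗ‖²` over all `(k, l)`, with the terms `(k, l)` and `(l, k)` paired. -/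
theorem two_mul_norm_hsVec_sq_eq_sum (r : n → ℝ) {G M : Matrix n n ℂ} (hG : G.IsHermitian)
    (hM : M.IsHermitian) :
    2 * ‖hsVec (G * diagonal (fun i => (r i : ℂ)) + diagonal (fun i => (r i : ℂ)) * M)‖ ^ 2 =
      ∑ k, ∑ l, (‖G k l * r l + r k * M k l‖ ^ 2 +
        ‖star (G k l) * r k + r l * star (M k l)‖ ^ 2) := by
  simp only [Finset.sum_add_distrib, hG.apply, hM.apply]
  rw [Finset.sum_comm (f := fun k l => ‖G l k * r k + r l * M l k‖ ^ 2), norm_hsVec_sq]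
  simp only [Matrix.add_apply, mul_diagonal, diagonal_mul]
  ring

theorem sum_le_four_mul_norm_hsVec_sq (r : n → ℝ) {G M : Matrix n n ℂ} (hG : G.IsHermitian)
    (hM : M.IsHermitian) :
    2 * ∑ k, ∑ l, (r k ^ 2 - r l ^ 2) ^ 2 / (r k ^ 2 + r l ^ 2) * ‖G k l‖ ^ 2 ≤
      4 * ‖hsVec (G * diagonal (fun i => (r i : ℂ)) + diagonal (fun i => (r i : ℂ)) * M)‖ ^ 2 := by
  have h := two_mul_norm_hsVec_sq_eq_sum r hG hM
  have h2 := Finset.sum_le_sum fun k (_ : k ∈ Finset.univ) =>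
    Finset.sum_le_sum fun l (_ : l ∈ Finset.univ) =>
      sq_sub_sq_div_mul_norm_sq_le (r k) (r l) (G k l) (M k l)
  linarith

theorem sum_eq_four_mul_norm_hsVec_sq (r : n → ℝ) {G : Matrix n n ℂ} (hG : G.IsHermitian) :
    2 * ∑ k, ∑ l, (r k ^ 2 - r l ^ 2) ^ 2 / (r k ^ 2 + r l ^ 2) * ‖G k l‖ ^ 2 =
      4 * ‖hsVec (G * diagonal (fun i => (r i : ℂ)) +
        diagonal (fun i => (r i : ℂ)) * optimalGenerator r G)‖ ^ 2 := by
  have h := two_mul_norm_hsVec_sq_eq_sum r hG (optimalGenerator_isHermitian r hG)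
  have h2 := Finset.sum_congr rfl fun k (_ : k ∈ Finset.univ) =>
    Finset.sum_congr rfl fun l (_ : l ∈ Finset.univ) =>
      sq_sub_sq_div_mul_norm_sq_eq (r k) (r l) (G k l) (optimalGenerator r G k l) rfl
  linarith

/-- The Sylvester equation `M R² + R² M = -2 R G R`. -/
theorem optimalGenerator_sylvester (r : n → ℝ) (G : Matrix n n ℂ) :
    optimalGenerator r G * diagonal (fun i => (r i : ℂ)) * diagonal (fun i => (r i : ℂ)) +
      diagonal (fun i => (r i : ℂ)) * diagonal (fun i => (r i : ℂ)) * optimalGenerator r G =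
      -(diagonal (fun i => (r i : ℂ)) * G * diagonal (fun i => (r i : ℂ)) +
        diagonal (fun i => (r i : ℂ)) * G * diagonal (fun i => (r i : ℂ))) := by
  ext k l
  simp only [Matrix.add_apply, Matrix.neg_apply, mul_diagonal, diagonal_mul, optimalGenerator,
    of_apply, diagonal_mul_diagonal]
  rcases (add_nonneg (sq_nonneg (r k)) (sq_nonneg (r l))).eq_or_lt with h | h
  · have hk : r k = 0 := by nlinarith [sq_nonneg (r k), sq_nonneg (r l)]
    have hl : r l = 0 := by nlinarith [sq_nonneg (r k), sq_nonneg (r l)]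
    simp [hk, hl]
  · have h' : (r k : ℂ) ^ 2 + (r l : ℂ) ^ 2 ≠ 0 := by exact_mod_cast h.ne'
    push_cast
    field_simp
    ring

/-- The entries of the optimal generator are those of `G` times factors in `[-1, 0]`, yet its
norm cannot exceed that of `G`: testing the Sylvester equation with a unit eigenvector `v` gives
`μ ‖R v‖² = -⟨R v, G R v⟩`. -/
theorem abs_eigenvalues_optimalGenerator_le (r : n → ℝ) {G : Matrix n n ℂ} (hG : G.IsHermitian)
    (i : n) : |(optimalGenerator_isHermitian r hG).eigenvalues i| ≤ opNorm G := by
  set hM := optimalGenerator_isHermitian r hG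
  set M := optimalGenerator r G with hMdef
  set R : Matrix n n ℂ := diagonal (fun i => (r i : ℂ)) with hR
  set μ := hM.eigenvalues i
  set v : n → ℂ := ⇑(hM.eigenvectorBasis i)
  have hMv : M *ᵥ v = (μ : ℂ) • v := hM.mulVec_eigenvectorBasis i
  have hv0 : v ≠ 0 := fun h => hM.eigenvectorBasis.orthonormal.ne_zero i (by
    ext k; exact congrFun h k)
  have hRh : Rᴴ = R := isHermitian_diagonal_of_self_adjoint _ (funext fun i => by simp)
  by_cases hRv : R *ᵥ v = 0
  · -- `M` vanishes on the kernel of `R`, so that `μ = 0`.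
    have hMv0 : M *ᵥ v = 0 := by
      ext k
      simp only [mulVec, dotProduct, Pi.zero_apply]
      refine Finset.sum_eq_zero fun l _ => ?_
      have h : (r l : ℂ) * v l = 0 := by
        have := congrFun hRv l
        rwa [hR, mulVec_diagonal] at this
      rcases mul_eq_zero.mp h with h | h
      · simp [hMdef, optimalGenerator, Complex.ofReal_eq_zero.mp h]
      · rw [h, mul_zero]
    rw [hMv, smul_eq_zero, or_iff_left hv0] at hMv0
    have : μ = 0 := by exact_mod_cast hMv0
    rw [this, abs_zero]
    exact norm_nonneg _
  · have hpos : 0 < (star (R *ᵥ v) ⬝ᵥ (R *ᵥ v)).re :=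
      (Complex.lt_def.mp (dotProduct_star_self_pos_iff.mpr hRv)).1
    have hadj : ∀ w, star v ⬝ᵥ R *ᵥ w = star (R *ᵥ v) ⬝ᵥ w := fun w => by
      rw [star_mulVec, hRh, dotProduct_mulVec]
    have hadjM : ∀ w, star v ⬝ᵥ M *ᵥ w = μ * (star v ⬝ᵥ w) := fun w => by
      rw [dotProduct_mulVec, ← hM.eq, ← star_mulVec, hMv, star_smul, smul_dotProduct]
      simp
    have key := congrArg (fun A : Matrix n n ℂ => star v ⬝ᵥ A *ᵥ v)
      (optimalGenerator_sylvester r G)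
    simp only [← hR, ← hMdef, add_mulVec, neg_mulVec, ← mulVec_mulVec, dotProduct_add,
      dotProduct_neg, hadjM, hMv, mulVec_smul, dotProduct_smul, hadj, smul_eq_mul] at key
    have key2 : (μ : ℂ) * (star (R *ᵥ v) ⬝ᵥ R *ᵥ v) = -(star (R *ᵥ v) ⬝ᵥ G *ᵥ (R *ᵥ v)) := by
      linear_combination key / 2
    have key3 := congrArg Complex.re key2
    rw [Complex.re_ofReal_mul, Complex.neg_re] at key3
    have hle := re_star_dotProduct_mulVec_abs_le G (R *ᵥ v)
    rw [← abs_neg, ← key3, abs_mul, abs_of_pos hpos] at hle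
    exact le_of_mul_le_mul_right hle hpos

/-- Every purification `√ρ W` and every Hermitian generator `h` on the ancilla bound the quantum
Fisher information of `ρ` from above. -/
theorem qfi_le_four_mul_norm_hsVec_sq (ρ : DensityMatrix n) {H h W : Matrix n n ℂ}
    (hH : H.IsHermitian) (hh : h.IsHermitian) (hW : W ∈ unitaryGroup n ℂ) :
    qfi ρ H ≤ 4 * ‖hsVec (H * (CFC.sqrt ρ.toMatrix * W) + CFC.sqrt ρ.toMatrix * W * h)‖ ^ 2 := by
  rw [qfi_eq_sum_entries, ρ.posSemidef.sqrt_eq_unitary_mul_diagonal_mul]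
  have hV := ρ.posSemidef.1.eigenvectorUnitary.2
  set V : Matrix n n ℂ := (ρ.posSemidef.1.eigenvectorUnitary : Matrix n n ℂ)
  have hr : ∀ k, ρ.eigenvalue k = √(ρ.posSemidef.1.eigenvalues k) ^ 2 := fun k =>
    (Real.sq_sqrt (ρ.posSemidef.eigenvalues_nonneg k)).symm
  simp only [hr]
  set r : n → ℝ := fun k => √(ρ.posSemidef.1.eigenvalues k)
  set R : Matrix n n ℂ := diagonal (fun k => (r k : ℂ))
  have hVV := conjTranspose_mul_self_of_mem_unitaryGroup hV
  have hWW := self_mul_conjTranspose_of_mem_unitaryGroup hW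
  have hrot : Vᴴ * (H * (V * R * Vᴴ * W) + V * R * Vᴴ * W * h) * (Wᴴ * V) =
      Vᴴ * H * V * R + R * ((Wᴴ * V)ᴴ * h * (Wᴴ * V)) := by
    calc _ = Vᴴ * H * V * R * (Vᴴ * (W * Wᴴ) * V) +
          (Vᴴ * V) * R * ((Wᴴ * V)ᴴ * h * (Wᴴ * V)) := by
          simp only [conjTranspose_mul, conjTranspose_conjTranspose, Matrix.mul_add,
            Matrix.add_mul, Matrix.mul_assoc]
      _ = _ := by simp only [hWW, hVV, Matrix.mul_one, Matrix.one_mul]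
  rw [← norm_hsVec_mul_unitary (mul_mem (conjTranspose_mem_unitaryGroup hW) hV),
    ← norm_hsVec_unitary_mul (conjTranspose_mem_unitaryGroup hV), ← Matrix.mul_assoc, hrot]
  exact sum_le_four_mul_norm_hsVec_sq r (isHermitian_conjTranspose_mul_mul V hH)
    (isHermitian_conjTranspose_mul_mul _ hh)

/-- For the purification `√ρ`, the bound by ancilla generators is attained at a generator of norm
at most `‖H‖`. -/
theorem exists_qfi_eq_four_mul_norm_hsVec_sq (ρ : DensityMatrix n) {H : Matrix n n ℂ}
    (hH : H.IsHermitian) :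
    ∃ h : Matrix n n ℂ, h.IsHermitian ∧
      (∀ X, ‖hsVec (X * h)‖ ≤ opNorm H * ‖hsVec X‖) ∧
      qfi ρ H = 4 * ‖hsVec (H * CFC.sqrt ρ.toMatrix + CFC.sqrt ρ.toMatrix * h)‖ ^ 2 := by
  rw [qfi_eq_sum_entries, ρ.posSemidef.sqrt_eq_unitary_mul_diagonal_mul]
  have hV := ρ.posSemidef.1.eigenvectorUnitary.2
  set V : Matrix n n ℂ := (ρ.posSemidef.1.eigenvectorUnitary : Matrix n n ℂ)
  have hr : ∀ k, ρ.eigenvalue k = √(ρ.posSemidef.1.eigenvalues k) ^ 2 := fun k =>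
    (Real.sq_sqrt (ρ.posSemidef.eigenvalues_nonneg k)).symm
  simp only [hr]
  set r : n → ℝ := fun k => √(ρ.posSemidef.1.eigenvalues k)
  set R : Matrix n n ℂ := diagonal (fun k => (r k : ℂ))
  have hVV := conjTranspose_mul_self_of_mem_unitaryGroup hV
  have hG := isHermitian_conjTranspose_mul_mul V hH
  set M := optimalGenerator r (Vᴴ * H * V)
  have hM : M.IsHermitian := optimalGenerator_isHermitian r hG
  refine ⟨V * M * Vᴴ, isHermitian_mul_mul_conjTranspose V hM, fun X => ?_, ?_⟩
  · rw [← Matrix.mul_assoc, norm_hsVec_mul_unitary (conjTranspose_mem_unitaryGroup hV),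
      ← Matrix.mul_assoc, ← norm_hsVec_mul_unitary hV X,
      ← opNorm_conjTranspose_mul_mul_of_mem_unitaryGroup hV H]
    exact norm_hsVec_mul_le_of_eigenvalues hM (norm_nonneg _)
      (abs_eigenvalues_optimalGenerator_le r hG) _
  · have hrot : Vᴴ * (H * (V * R * Vᴴ) + V * R * Vᴴ * (V * M * Vᴴ)) * V =
        Vᴴ * H * V * R + R * M := by
      calc _ = Vᴴ * H * V * R * (Vᴴ * V) + (Vᴴ * V) * R * (Vᴴ * V) * M * (Vᴴ * V) := by
            simp only [Matrix.mul_add, Matrix.add_mul, Matrix.mul_assoc]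
        _ = _ := by simp only [hVV, Matrix.mul_one, Matrix.one_mul]
    rw [← norm_hsVec_mul_unitary hV, ← norm_hsVec_unitary_mul (conjTranspose_mem_unitaryGroup hV),
      ← Matrix.mul_assoc, hrot]
    exact sum_eq_four_mul_norm_hsVec_sq r hG

end Variational

/-! ### Continuity of the quantum Fisher information -/

section Continuity

variable {n : Type*} [Fintype n] [DecidableEq n]

theorem qfi_sub_qfi_le (ρ σ : DensityMatrix n) {H : Matrix n n ℂ} (hH : H.IsHermitian) :
    qfi ρ H - qfi σ H ≤ 32 * √(1 - fidelity ρ σ ^ 2) * opNorm H ^ 2 := by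
  obtain ⟨h, hh, hbound, hσ⟩ := exists_qfi_eq_four_mul_norm_hsVec_sq σ hH
  obtain ⟨W, hW, hF⟩ := exists_unitary_inner_eq_fidelity ρ σ
  have hρ := qfi_le_four_mul_norm_hsVec_sq ρ hH hh hW
  have hΨ := ρ.norm_hsVec_sqrt
  rw [← norm_hsVec_mul_unitary hW] at hΨ
  have hΦ := σ.norm_hsVec_sqrt
  set Ψ := CFC.sqrt ρ.toMatrix * W
  set Φ := CFC.sqrt σ.toMatrix
  set t := opNorm H
  have ht : 0 ≤ t := norm_nonneg _
  let T : Matrix n n ℂ → EuclideanSpace ℂ (n × n) := fun X => hsVec (H * X + X * h)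
  have hT : ∀ X, ‖T X‖ ≤ 2 * t * ‖hsVec X‖ := fun X => by
    have h1 := norm_add_le (hsVec (H * X)) (hsVec (X * h))
    have h2 := norm_hsVec_mul_le H X
    have h3 := hbound X
    simp only [T, hsVec_add]
    linarith
  have hTadd : T Ψ + T Φ = T (Ψ + Φ) := by
    simp only [T, ← hsVec_add]; congr 1; noncomm_ring
  have hTsub : T Ψ - T Φ = T (Ψ - Φ) := by
    simp only [T, ← hsVec_sub]; congr 1; noncomm_ring
  have hadd : ‖hsVec (Ψ + Φ)‖ ^ 2 = 2 * (1 + fidelity ρ σ) := by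
    have h1 : ‖hsVec Ψ + hsVec Φ‖ ^ 2 = ‖hsVec Ψ‖ ^ 2 +
        2 * (inner ℂ (hsVec Ψ) (hsVec Φ) : ℂ).re + ‖hsVec Φ‖ ^ 2 := norm_add_sq (𝕜 := ℂ) _ _
    rw [hsVec_add, h1, hF, hΨ, hΦ]
    ring
  have hsub : ‖hsVec (Ψ - Φ)‖ ^ 2 = 2 * (1 - fidelity ρ σ) := by
    have h1 : ‖hsVec Ψ - hsVec Φ‖ ^ 2 = ‖hsVec Ψ‖ ^ 2 -
        2 * (inner ℂ (hsVec Ψ) (hsVec Φ) : ℂ).re + ‖hsVec Φ‖ ^ 2 := norm_sub_sq (𝕜 := ℂ) _ _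
    rw [hsVec_sub, h1, hF, hΨ, hΦ]
    ring
  have hprod : ‖hsVec (Ψ - Φ)‖ * ‖hsVec (Ψ + Φ)‖ = 2 * √(1 - fidelity ρ σ ^ 2) := by
    have h0 : 0 ≤ 1 - fidelity ρ σ ^ 2 := by
      nlinarith [fidelity_nonneg ρ σ, fidelity_le_one ρ σ]
    rw [← sq_eq_sq₀ (by positivity) (by positivity), mul_pow, mul_pow, hsub, hadd,
      Real.sq_sqrt h0]
    ring
  have hpol : ‖T Ψ‖ ^ 2 - ‖T Φ‖ ^ 2 ≤ ‖T (Ψ - Φ)‖ * ‖T (Ψ + Φ)‖ := by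
    rw [← hTadd, ← hTsub]
    have h2 : (inner ℂ (T Ψ - T Φ) (T Ψ + T Φ) : ℂ).re ≤ ‖T Ψ - T Φ‖ * ‖T Ψ + T Φ‖ :=
      re_inner_le_norm (𝕜 := ℂ) _ _
    have h3 : (inner ℂ (T Φ) (T Ψ) : ℂ).re = (inner ℂ (T Ψ) (T Φ) : ℂ).re :=
      inner_re_symm (𝕜 := ℂ) _ _
    have h4 : (inner ℂ (T Ψ) (T Ψ) : ℂ).re = ‖T Ψ‖ ^ 2 := inner_self_eq_norm_sq (𝕜 := ℂ) _
    have h5 : (inner ℂ (T Φ) (T Φ) : ℂ).re = ‖T Φ‖ ^ 2 := inner_self_eq_norm_sq (𝕜 := ℂ) _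
    rw [inner_sub_left, inner_add_right, inner_add_right] at h2
    simp only [Complex.sub_re, Complex.add_re] at h2
    linarith
  have hmul : ‖T (Ψ - Φ)‖ * ‖T (Ψ + Φ)‖ ≤
      (2 * t * ‖hsVec (Ψ - Φ)‖) * (2 * t * ‖hsVec (Ψ + Φ)‖) :=
    mul_le_mul (hT _) (hT _) (norm_nonneg _) (by positivity)
  calc
    qfi ρ H - qfi σ H ≤ 4 * (‖T Ψ‖ ^ 2 - ‖T Φ‖ ^ 2) := by
        rw [hσ, mul_sub]
        exact sub_le_sub_right hρ _
    _ ≤ 4 * ((2 * t * ‖hsVec (Ψ - Φ)‖) * (2 * t * ‖hsVec (Ψ + Φ)‖)) := by linarith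
    _ = 16 * t ^ 2 * (‖hsVec (Ψ - Φ)‖ * ‖hsVec (Ψ + Φ)‖) := by ring
    _ = _ := by rw [hprod]; ring

theorem sqrt_one_sub_fidelity_sq_le_buresDist (ρ σ : DensityMatrix n) :
    √(1 - fidelity ρ σ ^ 2) ≤ buresDist ρ σ := by
  refine Real.sqrt_le_sqrt ?_
  nlinarith [sq_nonneg (1 - fidelity ρ σ)]

end Continuity

theorem theorem1 {n : Type*} [Fintype n] [DecidableEq n] (ρ σ : DensityMatrix n)
    (H : Matrix n n ℂ) (hH : H.IsHermitian) :
    |qfi ρ H - qfi σ H| ≤ 32 * Real.sqrt (1 - fidelity ρ σ ^ 2) * opNorm H ^ 2 ∧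
    |qfi ρ H - qfi σ H| ≤ 32 * buresDist ρ σ * opNorm H ^ 2 ∧
    |qfi ρ H - qfi σ H| ≤
      32 * Real.sqrt (traceNorm (ρ.toMatrix - σ.toMatrix)) * opNorm H ^ 2 := by
  have h1 : |qfi ρ H - qfi σ H| ≤ 32 * √(1 - fidelity ρ σ ^ 2) * opNorm H ^ 2 := by
    rw [abs_sub_le_iff]
    refine ⟨qfi_sub_qfi_le ρ σ hH, ?_⟩
    rw [fidelity_comm]
    exact qfi_sub_qfi_le σ ρ hH
  have h2 : |qfi ρ H - qfi σ H| ≤ 32 * buresDist ρ σ * opNorm H ^ 2 := by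
    refine h1.trans ?_
    gcongr
    exact sqrt_one_sub_fidelity_sq_le_buresDist ρ σ
  refine ⟨h1, h2, h2.trans ?_⟩
  gcongr
  exact Real.sqrt_le_sqrt (two_mul_one_sub_fidelity_le_traceNorm ρ σ)
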